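/- Let $k,p,m\ge 1$ be integers, write $M_r=M_r(\mathbb C)$, identify $M_n\otimes M_r$ with $M_n(M_r)$ and $M_n(M_r)$ with $M_{nr}$, and for a linear map $\psi$ let $\psi^{(n)}$ be its entrywise application $(a_{ij})\mapsto(\psi(a_{ij}))$ to $n\times n$ matrices. We use the following definitions. (a) Let $S_k(M_p)$ be the set of linear maps $\psi:M_p\to M_k$ with $\psi(I_p)=I_k$ that are $k$-positive, i.e. $\psi^{(k)}(a)\ge 0$ for every positive semidefinite $a\in M_k(M_p)$. The operator system $\mathrm{OMIN}_k(M_p)$ is $M_p$ with unit $I_p$ and the matrix cones $$M_n(\mathrm{OMIN}_k(M_p))^+=\{(a_{ij})\in M_n(M_p):\ (\psi(a_{ij}))\ge 0\ \text{in } M_n(M_k)\ \text{for all }\psi\in S_k(M_p)\},\qquad n\ge 1.$$ A linear map $\phi:\mathrm{OMIN}_k(M_p)\to M_m$ is completely positive if, for every $n\ge1$, $\phi^{(n)}$ maps $M_n(\mathrm{OMIN}_k(M_p))^+$ into the positive semidefinite matrices in $M_n(M_m)$. (b) The Schmidt rank of $U\in\mathbb C^n\otimes\mathbb C^r$ is the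 rank of its $n\times r$ coefficient matrix. A state $s$ on $M_n\otimes M_r$ (a positive linear functional with $s(I)=1$) is $k$-separable if its density matrix $\rho_s=(s(E_{ij}\otimes E_{gh}))$ has Schmidt number at most $k$, where the Schmidt number of $\rho_s$ is the least $d$ such that $\rho_s$ is a finite sum of matrices $UU^*$ with $U\in\mathbb C^n\otimes\mathbb C^r$ of Schmidt rank at most $d$. A positive linear functional $f$ on $M_n\otimes M_r$ is $k$-separable if $f=0$ or $f/f(I_n\otimes I_r)$ is a $k$-separable state. (c) A linear map $\phi:M_p\to M_m$ is $k$-partially entanglement breaking if, for every $n\ge 1$ and every state $s$ on $M_n\otimes M_m$, the functional $s\circ\phi^{(n)}$ on $M_n\otimes M_p$ is positive and $k$-separable. **Theorem.** A linear map $\phi:M_p\to M_m$ is $k$-partially entanglement breaking if and only if $\phi:\mathrm{OMIN}_k(M_p)\to M_m$ is completely positive. -/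

import Mathlib

open scoped ComplexOrder

namespace KPEB

/-- The matrix algebra `M_m` of complex `m × m` matrices. -/
abbrev Mat (m : ℕ) : Type := Matrix (Fin m) (Fin m) ℂ

/-- A family of matrix cones on `V`: for every `n` a set `C n` of "positive" elements of
`M_n(V)`. -/
abbrev MatrixCones (V : Type*) : Type _ := (n : ℕ) → Set (Matrix (Fin n) (Fin n) V)

/-- The amplification `φ⁽ⁿ⁾ : M_n(V) → M_n(W)`, `(v i j) ↦ (φ (v i j))`. -/
def amp {V W : Type*} [AddCommGroup V] [Module ℂ V] [AddCommGroup W] [Module ℂ W]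
    (n : ℕ) (φ : V →ₗ[ℂ] W) :
    Matrix (Fin n) (Fin n) V →ₗ[ℂ] Matrix (Fin n) (Fin n) W :=
  φ.mapMatrix

/-- The natural operator system structure of `M_m ≅ B(ℂ^m)`: an element of `M_n(M_m)` is positive
if it is positive semidefinite as an `nm × nm` complex matrix. -/
def natCones (m : ℕ) : MatrixCones (Mat m) :=
  fun n => {a | (Matrix.comp (Fin n) (Fin n) (Fin m) (Fin m) ℂ a).PosSemidef}

/-- Complete positivity of a linear map between spaces with given matrix cones. -/
def IsCompletelyPositive {V W : Type*} [AddCommGroup V] [Module ℂ V] [AddCommGroup W]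
    [Module ℂ W] (C : MatrixCones V) (D : MatrixCones W) (φ : V →ₗ[ℂ] W) : Prop :=
  ∀ n : ℕ, ∀ a ∈ C n, amp n φ a ∈ D n

/-- The set `S_k(V)` of unital `k`-positive maps `V → M_k`, where `V` has matrix cones `C` and
unit `e`. -/
def matrixStates {V : Type*} [AddCommGroup V] [Module ℂ V] (k : ℕ) (C : MatrixCones V) (e : V) :
    Set (V →ₗ[ℂ] Mat k) :=
  {ψ | ψ e = 1 ∧ ∀ a ∈ C k, amp k ψ a ∈ natCones k k}

/-- The matrix cones of `OMIN_k`: those `(a i j) ∈ M_n(V)` with `(ψ (a i j)) ≥ 0` for every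
unital `k`-positive map `ψ : V → M_k`. -/
def ominCones {V : Type*} [AddCommGroup V] [Module ℂ V] (k : ℕ) (C : MatrixCones V) (e : V) :
    MatrixCones V :=
  fun n => {a | ∀ ψ ∈ matrixStates k C e, amp n ψ a ∈ natCones k n}

/-- Positive linear functionals on `M_n ⊗ M_m = M_n(M_m)`. -/
def IsPositiveFunctional {n m : ℕ} (f : Matrix (Fin n) (Fin n) (Mat m) →ₗ[ℂ] ℂ) : Prop :=
  ∀ a ∈ natCones m n, 0 ≤ f a

/-- States on `M_n ⊗ M_m = M_n(M_m)`. -/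
def IsState {n m : ℕ} (s : Matrix (Fin n) (Fin n) (Mat m) →ₗ[ℂ] ℂ) : Prop :=
  IsPositiveFunctional s ∧ s 1 = 1

/-- The density matrix (Choi matrix) `(s (E_ij ⊗ E_kl))` of a functional `s` on `M_n ⊗ M_m`;
`E_ij ⊗ E_kl` is the element of `M_n(M_m)` with the block `E_kl` in place `(i, j)`. -/
def densityMatrix {n m : ℕ} (s : Matrix (Fin n) (Fin n) (Mat m) →ₗ[ℂ] ℂ) :
    Matrix (Fin n × Fin m) (Fin n × Fin m) ℂ :=
  Matrix.of fun x y => s (Matrix.single x.1 y.1 (Matrix.single x.2 y.2 1))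

/-- The Schmidt rank of `U ∈ ℂ^n ⊗ ℂ^m`: the rank of its `n × m` coefficient matrix. -/
noncomputable def schmidtRank {n m : ℕ} (U : Fin n × Fin m → ℂ) : ℕ :=
  (Matrix.of fun (i : Fin n) (j : Fin m) => U (i, j)).rank

/-- `ρ` is a finite sum of matrices `U U*` with `U ∈ ℂ^n ⊗ ℂ^m` of Schmidt rank at most `r`. -/
def HasSchmidtDecomposition {n m : ℕ} (r : ℕ)
    (ρ : Matrix (Fin n × Fin m) (Fin n × Fin m) ℂ) : Prop :=
  ∃ (q : ℕ) (U : Fin q → Fin n × Fin m → ℂ),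
    (∀ l, schmidtRank (U l) ≤ r) ∧ ρ = ∑ l, Matrix.vecMulVec (U l) (star (U l))

/-- The Schmidt number of a positive semidefinite matrix `ρ`: the least `r` such that `ρ` is a
finite sum of matrices `U U*` with `U` of Schmidt rank at most `r`. -/
noncomputable def schmidtNumber {n m : ℕ} (ρ : Matrix (Fin n × Fin m) (Fin n × Fin m) ℂ) : ℕ :=
  sInf {r | HasSchmidtDecomposition r ρ}

/-- A `k`-separable state: a state whose density matrix has Schmidt number at most `k`. -/
def IsKSeparableState {n m : ℕ} (k : ℕ)
    (s : Matrix (Fin n) (Fin n) (Mat m) →ₗ[ℂ] ℂ) : Prop :=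
  IsState s ∧ schmidtNumber (densityMatrix s) ≤ k

/-- A `k`-separable positive functional: it is zero or its normalization is a `k`-separable
state. -/
def IsKSeparable {n m : ℕ} (k : ℕ) (f : Matrix (Fin n) (Fin n) (Mat m) →ₗ[ℂ] ℂ) : Prop :=
  IsPositiveFunctional f ∧ (f ≠ 0 → IsKSeparableState k ((f 1)⁻¹ • f))

/-- `φ : M_p → M_m` is `k`-partially entanglement breaking: `s ∘ φ⁽ⁿ⁾` is `k`-separable for every
`n` and every state `s` on `M_n ⊗ M_m`. -/
def IsKPEB {p m : ℕ} (k : ℕ) (φ : Mat p →ₗ[ℂ] Mat m) : Prop :=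
  ∀ (n : ℕ) (s : Matrix (Fin n) (Fin n) (Mat m) →ₗ[ℂ] ℂ),
    IsState s → IsKSeparable k (s ∘ₗ amp n φ)

end KPEB

/-! Two facts carry the proof. First, the positive cone of `OMIN_k` at level n consists exactly of
the k-block positive matrices, those whose quadratic form is nonnegative on vectors of Schmidt rank
at most k (`IsBlockPositive.mem_ominCones`, `isBlockPositive_of_mem_ominCones`). Second, under the
bilinear pairing ∑ M x y * ρ x y this cone is dual to the cone of matrices with a Schmidt
decomposition of rank at most k; the hard half is a Hahn–Banach separation
(`hasSchmidtDecomposition_of_forall_isBlockPositive`).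

The pairing of a with the density matrix of s ∘ φ⁽ⁿ⁾ is s(φ⁽ⁿ⁾(a)). Hence k-separability of these
functionals for all states s says that s(φ⁽ⁿ⁾(a)) ≥ 0 for all s and all k-block positive a, which is
positivity of φ⁽ⁿ⁾ on the `OMIN_k` cone. -/

/-- In a finite-dimensional real space the convex hull of a compact set is compact. -/
theorem IsCompact.convexHull_of_finiteDimensional {E : Type*} [NormedAddCommGroup E]
    [NormedSpace ℝ E] [FiniteDimensional ℝ E] {s : Set E} (hs : IsCompact s) :
    IsCompact (convexHull ℝ s) := by
  rcases s.eq_empty_or_nonempty with rfl | ⟨e, he⟩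
  · simp
  let N := Module.finrank ℝ E + 1
  let F : (Fin N → ℝ) × (Fin N → E) → E := fun q => ∑ i, q.1 i • q.2 i
  have hF : Continuous F := by fun_prop
  have hK : IsCompact (stdSimplex ℝ (Fin N) ×ˢ Set.univ.pi fun _ : Fin N => s) :=
    (isCompact_stdSimplex ℝ (Fin N)).prod (isCompact_univ_pi fun _ => hs)
  convert hK.image hF using 1
  apply Set.Subset.antisymm
  · intro x hx
    -- Carathéodory: affine independence bounds the number of points by N. Missing indices are
    -- filled with weight 0 at the point e.
    obtain ⟨ι, _, z, w, hz, hind, hw, hw1, rfl⟩ := eq_pos_convex_span_of_mem_convexHull hx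
    have hcard : Fintype.card ι ≤ Fintype.card (Fin N) := by
      simpa [N] using hind.card_le_finrank_succ.trans
        (Nat.add_le_add_right (Submodule.finrank_le _) 1)
    obtain ⟨c⟩ := Function.Embedding.nonempty_of_card_le hcard
    refine ⟨(Function.extend c w 0, Function.extend c z fun _ => e), ⟨⟨fun i => ?_, ?_⟩, ?_⟩, ?_⟩
    · by_cases hi : ∃ a, c a = i
      · obtain ⟨a, rfl⟩ := hi
        simpa [c.injective.extend_apply] using (hw a).le
      · simp [Function.extend_apply' _ _ _ hi]
    · rw [← hw1]
      have := Fintype.sum_of_injective c c.injective w (Function.extend c w 0)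
        (fun i hi => by simpa using Function.extend_apply' w (0 : Fin N → ℝ) i hi)
        (fun i => (c.injective.extend_apply w 0 i).symm)
      exact this.symm
    · intro i _
      by_cases hi : ∃ a, c a = i
      · obtain ⟨a, rfl⟩ := hi
        simpa [c.injective.extend_apply] using hz ⟨a, rfl⟩
      · simpa [Function.extend_apply' _ _ _ hi] using he
    · refine (Fintype.sum_of_injective c c.injective _ _ (fun i hi => ?_) fun i => ?_).symm
      · have hi' : ¬ ∃ a, c a = i := hi
        simp [Function.extend_apply' _ _ _ hi']
      · simp [c.injective.extend_apply]
  · rintro _ ⟨⟨w, z⟩, ⟨hw, hz⟩, rfl⟩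
    exact mem_convexHull_of_exists_fintype w z hw.1 hw.2 (fun i => hz i trivial) rfl

/-! ### Positive semidefinite matrices and partial isometries. -/

namespace Matrix

/-- Over `ℂ` a matrix with nonnegative quadratic form is positive semidefinite. -/
theorem posSemidef_of_forall_nonneg {ι : Type*} [Fintype ι] [DecidableEq ι] {M : Matrix ι ι ℂ}
    (h : ∀ v : ι → ℂ, 0 ≤ star v ⬝ᵥ (M *ᵥ v)) : M.PosSemidef := by
  refine PosSemidef.of_dotProduct_mulVec_nonneg ?_ h
  rw [← isSymmetric_toEuclideanLin_iff, LinearMap.isSymmetric_iff_inner_map_self_real]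
  intro v
  have := (Complex.nonneg_iff.1 (h v.ofLp)).2
  rw [Complex.conj_eq_iff_im]
  rw [← inner_conj_symm, Complex.conj_im]
  simpa [EuclideanSpace.inner_eq_star_dotProduct, dotProduct_comm, eq_comm] using this

theorem dotProduct_mulVec_eq_sum {ι : Type*} [Fintype ι] (M : Matrix ι ι ℂ) (v : ι → ℂ) :
    star v ⬝ᵥ (M *ᵥ v) = ∑ x, ∑ y, star (v x) * M x y * v y := by
  simp [dotProduct, mulVec, Finset.mul_sum, mul_assoc]

/-- A matrix of rank at most `k` is fixed by a projection `Q Qᴴ`, where `Q` is a partial isometry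
with `k` columns. -/
theorem exists_partialIsometry_of_rank_le {p n k : ℕ} (M : Matrix (Fin p) (Fin n) ℂ)
    (hM : M.rank ≤ k) :
    ∃ Q : Matrix (Fin p) (Fin k) ℂ, Q * Qᴴ * M = M ∧ Q * Qᴴ * Q = Q := by
  let W := LinearMap.range (toEuclideanLin M)
  have hd : Module.finrank ℂ W ≤ k := by
    refine le_trans (le_of_eq ?_) hM
    rw [rank_eq_finrank_range_toLin M (PiLp.basisFun 2 ℂ (Fin p)) (PiLp.basisFun 2 ℂ (Fin n))]
    rfl
  let b := stdOrthonormalBasis ℂ W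
  let Q₀ : Matrix (Fin p) (Fin (Module.finrank ℂ W)) ℂ :=
    of fun x g => (b g : EuclideanSpace ℂ (Fin p)) x
  -- J appends zero columns to reach width k, so the product Q₀ * J is only a partial isometry.
  let J : Matrix (Fin (Module.finrank ℂ W)) (Fin k) ℂ :=
    of fun i g => if Fin.castLE hd i = g then 1 else 0
  have hJ : J * Jᴴ = 1 := by
    ext i j
    simp [J, mul_apply, one_apply, eq_comm]
  have hQ : Q₀ᴴ * Q₀ = 1 := by
    ext i j
    have := orthonormal_iff_ite.1 b.orthonormal i j
    rw [Submodule.coe_inner, EuclideanSpace.inner_eq_star_dotProduct] at this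
    simpa [Q₀, mul_apply, one_apply, dotProduct, mul_comm] using this
  have hQM : Q₀ * Q₀ᴴ * M = M := by
    ext x j
    let v : W := ⟨toEuclideanLin M (EuclideanSpace.single j 1), ⟨_, rfl⟩⟩
    have hv : ∀ y, (v : EuclideanSpace ℂ (Fin p)) y = M y j := by
      intro y
      simp [v, toLpLin_apply]
    have := congrArg (fun t : W => (t : EuclideanSpace ℂ (Fin p)) x) (b.sum_repr v)
    simp only [b.repr_apply_apply, Submodule.coe_inner,
      EuclideanSpace.inner_eq_star_dotProduct] at this
    rw [hv] at this
    rw [← this]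
    simp only [Q₀, mul_apply, dotProduct, hv, Finset.sum_mul, conjTranspose_apply, of_apply,
      Submodule.coe_sum, Submodule.coe_smul, WithLp.ofLp_sum, WithLp.ofLp_smul, Finset.sum_apply,
      Pi.smul_apply, Pi.star_apply, smul_eq_mul]
    rw [Finset.sum_comm]
    exact Finset.sum_congr rfl fun _ _ => Finset.sum_congr rfl fun _ _ => by ring
  refine ⟨Q₀ * J, ?_, ?_⟩
  · rw [conjTranspose_mul, Matrix.mul_assoc Q₀, ← Matrix.mul_assoc J, hJ, Matrix.one_mul, hQM]
  · rw [conjTranspose_mul, Matrix.mul_assoc Q₀, ← Matrix.mul_assoc J, hJ, Matrix.one_mul,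
      Matrix.mul_assoc, ← Matrix.mul_assoc Q₀ᴴ, hQ, Matrix.one_mul]

end Matrix

/-! ### Block positivity and the cones of `OMIN_k`. -/

namespace KPEB

open Matrix

/-- `M` has nonnegative quadratic form on the vectors of Schmidt rank at most `k`. -/
def IsBlockPositive {n m : ℕ} (k : ℕ) (M : Matrix (Fin n × Fin m) (Fin n × Fin m) ℂ) : Prop :=
  ∀ U : Fin n × Fin m → ℂ, schmidtRank U ≤ k → 0 ≤ star U ⬝ᵥ (M *ᵥ U)

theorem schmidtRank_mul_le {n m k : ℕ} (A : Matrix (Fin n) (Fin k) ℂ)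
    (B : Matrix (Fin k) (Fin m) ℂ) : schmidtRank (fun x => (A * B) x.1 x.2) ≤ k :=
  (rank_mul_le_left A B).trans (by simpa using A.rank_le_card_width)

theorem schmidtRank_smul_le {n m : ℕ} (c : ℂ) (U : Fin n × Fin m → ℂ) :
    schmidtRank (c • U) ≤ schmidtRank U := by
  have h : (of fun (i : Fin n) (j : Fin m) => (c • U) (i, j)) =
      (c • (1 : Matrix (Fin n) (Fin n) ℂ)) * of fun i j => U (i, j) := by
    ext; simp
  unfold schmidtRank
  rw [h]
  exact rank_mul_le_right _ _

theorem schmidtRank_star {n m : ℕ} (U : Fin n × Fin m → ℂ) :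
    schmidtRank (star U) = schmidtRank U := by
  have h : (of fun (i : Fin n) (j : Fin m) => (star U) (i, j)) =
      ((of fun (i : Fin n) (j : Fin m) => U (i, j))ᵀ)ᴴ := by
    ext; simp
  unfold schmidtRank
  rw [h, rank_conjTranspose, rank_transpose]

theorem sum_comm₂ {α β γ δ : Type*} [Fintype α] [Fintype β] [Fintype γ] [Fintype δ]
    (f : α → β → γ → δ → ℂ) :
    ∑ a, ∑ b, ∑ c, ∑ d, f a b c d = ∑ c, ∑ d, ∑ a, ∑ b, f a b c d := by
  calc _ = ∑ z : α × β, ∑ w : γ × δ, f z.1 z.2 w.1 w.2 := by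
        simp_rw [Fintype.sum_prod_type]
    _ = ∑ w : γ × δ, ∑ z : α × β, f z.1 z.2 w.1 w.2 := Finset.sum_comm
    _ = _ := by simp_rw [Fintype.sum_prod_type]

theorem form_comp {n m : ℕ} (a : Matrix (Fin n) (Fin n) (Mat m)) (v : Fin n × Fin m → ℂ) :
    star v ⬝ᵥ (comp (Fin n) (Fin n) (Fin m) (Fin m) ℂ a *ᵥ v) =
      ∑ i, ∑ j, ∑ g, ∑ h, star (v (i, g)) * a i j g h * v (j, h) := by
  rw [dotProduct_mulVec_eq_sum]
  simp only [Fintype.sum_prod_type, comp_apply]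
  exact Finset.sum_congr rfl fun i _ => Finset.sum_comm

/-- Compressing the first tensor factor of a block positive matrix by an `n × k` matrix gives a
positive element of `M_k(M_p)`. -/
theorem IsBlockPositive.compress_mem_natCones {k n p : ℕ} {a : Matrix (Fin n) (Fin n) (Mat p)}
    (ha : IsBlockPositive k (comp (Fin n) (Fin n) (Fin p) (Fin p) ℂ a))
    (w : Matrix (Fin n) (Fin k) ℂ) :
    (of fun g h => ∑ i, ∑ j, (star (w i g) * w j h) • a i j :
      Matrix (Fin k) (Fin k) (Mat p)) ∈ natCones p k := by
  refine posSemidef_of_forall_nonneg fun u => ?_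
  -- The form of the compression at u is the form of a at w * u, which factors through ℂ^k.
  have h := ha _ (schmidtRank_mul_le w (of fun g x => u (g, x)))
  rw [form_comp] at h ⊢
  convert h using 1
  simp only [of_apply, Matrix.sum_apply, Matrix.smul_apply, smul_eq_mul, mul_apply, star_sum, star_mul',
    Finset.sum_mul, Finset.mul_sum]
  calc _ = ∑ g, ∑ h, ∑ x, ∑ y, ∑ i, ∑ j,
        star (u (g, x)) * (star (w i g) * w j h * a i j x y) * u (h, y) := rfl
    _ = ∑ g, ∑ h, ∑ i, ∑ j, ∑ x, ∑ y,
        star (u (g, x)) * (star (w i g) * w j h * a i j x y) * u (h, y) :=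
      Finset.sum_congr rfl fun g _ => Finset.sum_congr rfl fun h _ => sum_comm₂ _
    _ = ∑ i, ∑ j, ∑ g, ∑ h, ∑ x, ∑ y,
        star (u (g, x)) * (star (w i g) * w j h * a i j x y) * u (h, y) := sum_comm₂ _
    _ = ∑ i, ∑ j, ∑ x, ∑ y, ∑ g, ∑ h,
        star (u (g, x)) * (star (w i g) * w j h * a i j x y) * u (h, y) :=
      Finset.sum_congr rfl fun i _ => Finset.sum_congr rfl fun j _ => sum_comm₂ _
    _ = _ := by
      refine Finset.sum_congr rfl fun i _ => Finset.sum_congr rfl fun j _ =>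
        Finset.sum_congr rfl fun x _ => Finset.sum_congr rfl fun y _ => ?_
      rw [Finset.sum_comm]
      exact Finset.sum_congr rfl fun _ _ => Finset.sum_congr rfl fun _ _ => by ring

/-- Compress a by the coefficient matrix of w to get b ≥ 0 in M_k(M_p). The form of ψ⁽ⁿ⁾(a) at w
equals that of ψ⁽ᵏ⁾(b) at ∑ e_g ⊗ e_g, so k-positivity of ψ suffices. -/
theorem IsBlockPositive.mem_ominCones {k n p : ℕ} {a : Matrix (Fin n) (Fin n) (Mat p)}
    (ha : IsBlockPositive k (comp (Fin n) (Fin n) (Fin p) (Fin p) ℂ a)) :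
    a ∈ ominCones k (natCones p) 1 n := by
  rintro ψ ⟨-, hψ⟩
  refine posSemidef_of_forall_nonneg fun w => ?_
  have h := (hψ _ (ha.compress_mem_natCones (of fun i g => w (i, g)))).dotProduct_mulVec_nonneg
    fun x => if x.1 = x.2 then 1 else 0
  rw [form_comp] at h ⊢
  convert h using 1
  simp only [amp, LinearMap.mapMatrix_apply, map_apply, of_apply, map_sum, map_smul, Matrix.sum_apply,
    Matrix.smul_apply, smul_eq_mul, apply_ite star, star_one, star_zero, ite_mul, one_mul, zero_mul,
    mul_ite, mul_one, mul_zero, Finset.sum_ite_eq, Finset.mem_univ, if_true]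
  rw [sum_comm₂]
  exact Finset.sum_congr rfl fun _ _ => Finset.sum_congr rfl fun _ _ =>
    Finset.sum_congr rfl fun _ _ => Finset.sum_congr rfl fun _ _ => by ring

/-- The unital map `x ↦ Qᴴ x Q + p⁻¹ tr(x) (1 - Qᴴ Q)`. -/
noncomputable def isometryState {p k : ℕ} (Q : Matrix (Fin p) (Fin k) ℂ) : Mat p →ₗ[ℂ] Mat k where
  toFun x := Qᴴ * x * Q + ((p : ℂ)⁻¹ * x.trace) • (1 - Qᴴ * Q)
  map_add' x y := by
    simp only [Matrix.mul_add, Matrix.add_mul, trace_add, mul_add, add_smul]; abel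
  map_smul' c x := by
    simp only [Matrix.mul_smul, Matrix.smul_mul, trace_smul, smul_eq_mul, RingHom.id_apply,
      smul_add, smul_smul, mul_left_comm]

theorem isometryState_apply {p k : ℕ} (Q : Matrix (Fin p) (Fin k) ℂ) (x : Mat p) :
    isometryState Q x = Qᴴ * x * Q + ((p : ℂ)⁻¹ * x.trace) • (1 - Qᴴ * Q) := rfl

/-- Qᴴ * Q is a projection, and the trace term supplies the missing part of the unit. Amplified, the
map is a congruence plus a Kronecker product of two positive matrices: a normalized partial trace
and 1 - Qᴴ * Q. -/
theorem isometryState_mem_matrixStates {p k : ℕ} (hp : p ≠ 0) {Q : Matrix (Fin p) (Fin k) ℂ}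
    (hQ : Q * Qᴴ * Q = Q) : isometryState Q ∈ matrixStates k (natCones p) 1 := by
  have hp' : (p : ℂ) ≠ 0 := by exact_mod_cast hp
  refine ⟨by simp [isometryState_apply, hp'], fun b hb => ?_⟩
  have hR : (1 - Qᴴ * Q).PosSemidef := by
    have : 1 - Qᴴ * Q = (1 - Qᴴ * Q)ᴴ * (1 - Qᴴ * Q) := by
      have h : Qᴴ * Q * (Qᴴ * Q) = Qᴴ * Q := by
        rw [Matrix.mul_assoc, ← Matrix.mul_assoc Q, hQ]
      simp [Matrix.sub_mul, Matrix.mul_sub, h]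
    rw [this]
    exact posSemidef_conjTranspose_mul_self _
  have hT : (of fun i j => (p : ℂ)⁻¹ * (b i j).trace : Mat k).PosSemidef := by
    have : (of fun i j => (p : ℂ)⁻¹ * (b i j).trace : Mat k) = (p : ℂ)⁻¹ •
        ∑ x : Fin p, (comp (Fin k) (Fin k) (Fin p) (Fin p) ℂ b).submatrix
          (fun i => (i, x)) (fun i => (i, x)) := by
      ext i j
      simp [Matrix.sum_apply, trace]
    rw [this]
    refine PosSemidef.smul (posSemidef_sum _ fun x _ => PosSemidef.submatrix hb _) ?_
    exact inv_nonneg.2 (Nat.cast_nonneg p)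
  have h1 : (comp (Fin k) (Fin k) (Fin k) (Fin k) ℂ (b.map fun x => Qᴴ * x * Q)).PosSemidef := by
    convert hb.conjTranspose_mul_mul_same (kronecker (1 : Mat k) Q) using 1
    ext ⟨i, g⟩ ⟨j, h⟩
    simp [mul_apply, Fintype.sum_prod_type, one_apply, Finset.sum_mul, apply_ite]
  have h2 : comp (Fin k) (Fin k) (Fin k) (Fin k) ℂ (amp k (isometryState Q) b) =
      comp (Fin k) (Fin k) (Fin k) (Fin k) ℂ (b.map fun x => Qᴴ * x * Q) +
        kronecker (of fun i j => (p : ℂ)⁻¹ * (b i j).trace : Mat k) (1 - Qᴴ * Q) := rfl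
  change PosSemidef _
  rw [h2]
  exact h1.add (hT.kronecker hR)

/-- A vector of Schmidt rank at most k has Vᵀ = Q * w with k columns in Q. Since 1 - Qᴴ * Q kills w,
the form of a at v is that of the amplified `isometryState Q` at w. -/
theorem isBlockPositive_of_mem_ominCones {k n p : ℕ} {a : Matrix (Fin n) (Fin n) (Mat p)}
    (ha : a ∈ ominCones k (natCones p) 1 n) :
    IsBlockPositive k (comp (Fin n) (Fin n) (Fin p) (Fin p) ℂ a) := by
  intro v hv
  rcases Nat.eq_zero_or_pos p with rfl | hp
  · simp [dotProduct]
  set V : Matrix (Fin n) (Fin p) ℂ := of fun i j => v (i, j) with hV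
  obtain ⟨Q, hQV, hQ⟩ := exists_partialIsometry_of_rank_le Vᵀ
    (by rw [rank_transpose]; exact hv : Vᵀ.rank ≤ k)
  set w := Qᴴ * Vᵀ with hw
  have hQw : Q * w = Vᵀ := by rw [hw, ← Matrix.mul_assoc, hQV]
  have hRw : (1 - Qᴴ * Q) * w = 0 := by
    rw [Matrix.sub_mul, Matrix.one_mul, Matrix.mul_assoc, hQw, sub_self]
  have h := (ha _ (isometryState_mem_matrixStates hp.ne' hQ)).dotProduct_mulVec_nonneg
    fun x => w x.2 x.1
  rw [form_comp] at h ⊢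
  convert h using 1
  refine Finset.sum_congr rfl fun i _ => Finset.sum_congr rfl fun j _ => ?_
  have key : ∀ (r : ℕ) (X : Mat r) (u : Matrix (Fin r) (Fin n) ℂ),
      ∑ g, ∑ h, star (u g i) * X g h * u h j = (uᴴ * (X * u)) i j := by
    intro r X u
    simp [mul_apply, Finset.mul_sum, mul_assoc]
  have e1 := key p (a i j) Vᵀ
  have e2 := key k (isometryState Q (a i j)) w
  simp only [transpose_apply, hV, of_apply] at e1
  simp only [amp, LinearMap.mapMatrix_apply, map_apply]
  rw [e1, e2, isometryState_apply, Matrix.add_mul, Matrix.smul_mul, hRw, smul_zero, add_zero,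
    ← hV, ← hQw, conjTranspose_mul]
  simp only [Matrix.mul_assoc]

/-! ### Schmidt decompositions and their duality with block positivity. -/

theorem isClosed_setOf_schmidtRank_le (n m k : ℕ) :
    IsClosed {U : Fin n × Fin m → ℂ | schmidtRank U ≤ k} := by
  let T : (Fin n × Fin m → ℂ) →ₗ[ℂ] (Fin m → ℂ) →L[ℂ] (Fin n → ℂ) :=
    LinearMap.toContinuousLinearMap.toLinearMap ∘ₗ
      (Matrix.toLin' : Matrix (Fin n) (Fin m) ℂ ≃ₗ[ℂ] _).toLinearMap ∘ₗ
      { toFun := fun U => of fun i j => U (i, j)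
        map_add' := fun _ _ => rfl
        map_smul' := fun _ _ => rfl }
  have hT : Continuous T := T.continuous_of_finiteDimensional
  have h := (isOpen_setOfPred_nat_le_rank (𝕜 := ℂ) (E := Fin m → ℂ) (F := Fin n → ℂ)
    (k + 1)).preimage hT
  rw [← isOpen_compl_iff]
  convert h using 1
  ext U
  have e : ((T U : (Fin m → ℂ) →ₗ[ℂ] (Fin n → ℂ)).rank) = (schmidtRank U : Cardinal) := by
    rw [LinearMap.rank, ← Module.finrank_eq_rank]
    rfl
  change ¬ schmidtRank U ≤ k ↔
    ((k + 1 : ℕ) : Cardinal) ≤ (T U : (Fin m → ℂ) →ₗ[ℂ] (Fin n → ℂ)).rank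
  rw [e, Nat.cast_le, not_le, Nat.succ_le_iff]

theorem HasSchmidtDecomposition.of_fintype {n m r : ℕ} {ι : Type*} [Fintype ι]
    (U : ι → Fin n × Fin m → ℂ) (hU : ∀ l, schmidtRank (U l) ≤ r) :
    HasSchmidtDecomposition r (∑ l, vecMulVec (U l) (star (U l))) :=
  ⟨Fintype.card ι, fun l => U ((Fintype.equivFin ι).symm l), fun _ => hU _,
    ((Fintype.equivFin ι).symm.sum_comp fun l => vecMulVec (U l) (star (U l))).symm⟩

theorem HasSchmidtDecomposition.mono {n m r t : ℕ}
    {ρ : Matrix (Fin n × Fin m) (Fin n × Fin m) ℂ} (h : HasSchmidtDecomposition r ρ)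
    (hrt : r ≤ t) : HasSchmidtDecomposition t ρ :=
  let ⟨q, U, hU, e⟩ := h
  ⟨q, U, fun l => (hU l).trans hrt, e⟩

theorem HasSchmidtDecomposition.smul {n m r : ℕ}
    {ρ : Matrix (Fin n × Fin m) (Fin n × Fin m) ℂ} (h : HasSchmidtDecomposition r ρ)
    {c : ℝ} (hc : 0 ≤ c) : HasSchmidtDecomposition r ((c : ℂ) • ρ) := by
  obtain ⟨q, U, hU, rfl⟩ := h
  refine ⟨q, fun l => (Real.sqrt c : ℂ) • U l, fun l => (schmidtRank_smul_le _ _).trans (hU l), ?_⟩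
  rw [Finset.smul_sum]
  refine Finset.sum_congr rfl fun l _ => ?_
  have : (Real.sqrt c : ℂ) * Real.sqrt c = c := by
    rw [← Complex.ofReal_mul, Real.mul_self_sqrt hc]
  rw [star_smul, smul_vecMulVec, vecMulVec_smul, smul_smul, ← this]
  simp

/-- Makes the infimum in `schmidtNumber` an attained minimum rather than the default value 0 of an
empty `sInf`. -/
theorem exists_hasSchmidtDecomposition_of_posSemidef {n m : ℕ}
    {ρ : Matrix (Fin n × Fin m) (Fin n × Fin m) ℂ} (hρ : ρ.PosSemidef) :
    ∃ r, HasSchmidtDecomposition r ρ := by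
  open scoped MatrixOrder in
  obtain ⟨B, rfl⟩ := CStarAlgebra.nonneg_iff_eq_star_mul_self.mp hρ.nonneg
  have : star B * B = ∑ l, vecMulVec (star (B l)) (star (star (B l))) := by
    ext x y
    simp [star_eq_conjTranspose, mul_apply, Matrix.sum_apply, vecMulVec_apply]
  rw [this]
  exact ⟨m, HasSchmidtDecomposition.of_fintype _ fun l =>
    (rank_le_card_width _).trans (Fintype.card_fin m).le⟩

theorem form_star_eq_sum {n m : ℕ} (M : Matrix (Fin n × Fin m) (Fin n × Fin m) ℂ)
    (U : Fin n × Fin m → ℂ) :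
    star (star U) ⬝ᵥ (M *ᵥ star U) = ∑ x, ∑ y, M x y * vecMulVec U (star U) x y := by
  rw [dotProduct_mulVec_eq_sum]
  simp only [Pi.star_apply, star_star, vecMulVec_apply]
  exact Finset.sum_congr rfl fun _ _ => Finset.sum_congr rfl fun _ _ => by ring

/-- The pairing is not sesquilinear, so each term U U* contributes the form at `star U`, which has
the same Schmidt rank. -/
theorem IsBlockPositive.sum_mul_nonneg {n m k : ℕ}
    {M ρ : Matrix (Fin n × Fin m) (Fin n × Fin m) ℂ} (hM : IsBlockPositive k M)
    (hρ : HasSchmidtDecomposition k ρ) : 0 ≤ ∑ x, ∑ y, M x y * ρ x y := by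
  obtain ⟨q, U, hU, rfl⟩ := hρ
  have : ∑ x, ∑ y, M x y * (∑ l, vecMulVec (U l) (star (U l))) x y =
      ∑ l, star (star (U l)) ⬝ᵥ (M *ᵥ star (U l)) := by
    simp only [form_star_eq_sum, Matrix.sum_apply, Finset.mul_sum]
    conv_rhs => rw [Finset.sum_comm]
    exact Finset.sum_congr rfl fun _ _ => Finset.sum_comm
  rw [this]
  exact Finset.sum_nonneg fun l _ => hM _ ((schmidtRank_star _).trans_le (hU l))

/-- A linear functional on matrices is the pairing with its matrix of values; the associated
hermitian matrix, shifted by a scalar, has this pairing with a hermitian matrix. -/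
theorem sum_hermitianPart_mul {ι : Type*} [Fintype ι] [DecidableEq ι]
    (g : Matrix ι ι ℂ →ₗ[ℂ] ℂ) (u : ℝ) {ρ : Matrix ι ι ℂ} (hρ : ρ.IsHermitian) :
    ∑ x, ∑ y, (of fun x y => (g (single x y 1) + star (g (single y x 1))) / 2 -
      if x = y then (u : ℂ) else 0) x y * ρ x y = ((g ρ).re : ℂ) - u * ρ.trace := by
  have hg : g ρ = ∑ x, ∑ y, g (single x y 1) * ρ x y := by
    conv_lhs => rw [matrix_eq_sum_single ρ]
    simp only [map_sum]
    refine Finset.sum_congr rfl fun x _ => Finset.sum_congr rfl fun y _ => ?_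
    have : single x y (ρ x y) = ρ x y • single x y (1 : ℂ) := by simp [smul_single]
    rw [this, map_smul, smul_eq_mul, mul_comm]
  have hg' : star (g ρ) = ∑ x, ∑ y, star (g (single y x 1)) * ρ x y := by
    rw [hg, star_sum, Finset.sum_comm]
    simp only [star_sum, star_mul']
    rw [Finset.sum_comm, Finset.sum_comm]
    refine Finset.sum_congr rfl fun x _ => Finset.sum_congr rfl fun y _ => ?_
    rw [hρ.apply]
  have hre : ((g ρ).re : ℂ) = (g ρ + star (g ρ)) / 2 := by
    rw [Complex.re_eq_add_conj]; rfl
  rw [hre, hg', hg, trace, Finset.mul_sum, ← Finset.sum_add_distrib, Finset.sum_div,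
    ← Finset.sum_sub_distrib]
  refine Finset.sum_congr rfl fun x _ => ?_
  simp only [of_apply, sub_mul, Finset.sum_sub_distrib, ite_mul, zero_mul, Finset.sum_ite_eq,
    Finset.mem_univ, if_true, diag_apply, ← Finset.sum_add_distrib, Finset.sum_div]
  congr 1
  exact Finset.sum_congr rfl fun _ _ => by ring

attribute [local instance] Matrix.normedAddCommGroup Matrix.normedSpace

/-- If ρ lies outside the compact convex hull of the bounded U U*, a functional separates it at
level u. Its hermitian part minus u times the identity is k-block positive but pairs negatively with
ρ, because the trace of ρ is 1. -/
theorem hasSchmidtDecomposition_of_trace_eq_one {n m k : ℕ}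
    {ρ : Matrix (Fin n × Fin m) (Fin n × Fin m) ℂ} (hρ : ρ.IsHermitian) (htr : ρ.trace = 1)
    (h : ∀ M, IsBlockPositive k M → 0 ≤ ∑ x, ∑ y, M x y * ρ x y) :
    HasSchmidtDecomposition k ρ := by
  -- The ball is for the sup norm; it contains every Euclidean unit vector.
  let S : Set (Fin n × Fin m → ℂ) := Metric.closedBall 0 1 ∩ {U | schmidtRank U ≤ k}
  have hS : IsCompact S :=
    (isCompact_closedBall 0 1).inter_right (isClosed_setOf_schmidtRank_le n m k)
  let F : (Fin n × Fin m → ℂ) → Matrix (Fin n × Fin m) (Fin n × Fin m) ℂ :=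
    fun U => vecMulVec U (star U)
  have hF : Continuous F := by
    refine continuous_pi fun x => continuous_pi fun y => ?_
    simp only [F, vecMulVec_apply, Pi.star_apply]
    fun_prop
  by_cases hmem : ρ ∈ convexHull ℝ (F '' S)
  · obtain ⟨ι, _, w, z, hw, -, hz, rfl⟩ := mem_convexHull_iff_exists_fintype.1 hmem
    choose U hU hUz using hz
    have : ∑ i, w i • z i =
        ∑ i, vecMulVec ((Real.sqrt (w i) : ℂ) • U i) (star ((Real.sqrt (w i) : ℂ) • U i)) := by
      refine Finset.sum_congr rfl fun l _ => ?_
      have e : (Real.sqrt (w l) : ℂ) * Real.sqrt (w l) = w l := by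
        rw [← Complex.ofReal_mul, Real.mul_self_sqrt (hw l)]
      rw [star_smul, smul_vecMulVec, vecMulVec_smul, smul_smul, ← hUz]
      simp [e, F]
    rw [this]
    exact .of_fintype _ fun l => (schmidtRank_smul_le _ _).trans (hU l).2
  · exfalso
    obtain ⟨g, u, hgρ, hg⟩ := RCLike.geometric_hahn_banach_point_closed (𝕜 := ℂ)
      (convex_convexHull ℝ _) (hS.image hF).convexHull_of_finiteDimensional.isClosed hmem
    have hgS : ∀ U ∈ S, u < (g (F U)).re := fun U hU =>
      hg _ (subset_convexHull ℝ _ ⟨U, hU, rfl⟩)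
    have hu : u < 0 := by
      have h0 : (0 : Fin n × Fin m → ℂ) ∈ S :=
        ⟨by simp, by
          simpa [Pi.zero_def] using (schmidtRank_mul_le (0 : Matrix (Fin n) (Fin k) ℂ)
            (0 : Matrix (Fin k) (Fin m) ℂ))⟩
      simpa [F] using hgS 0 h0
    have hblock := h (of fun x y => (g (single x y 1) + star (g (single y x 1))) / 2 -
      if x = y then (u : ℂ) else 0) ?_
    · have e := sum_hermitianPart_mul (g : _ →ₗ[ℂ] ℂ) u hρ
      simp only [ContinuousLinearMap.coe_coe] at e
      rw [e, htr, mul_one, ← Complex.ofReal_sub] at hblock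
      have := Complex.zero_le_real.1 hblock
      have : (g ρ).re < u := hgρ
      linarith
    · intro U hU
      have hU' : schmidtRank (star U) ≤ k := (schmidtRank_star U).trans_le hU
      have e := sum_hermitianPart_mul (g : _ →ₗ[ℂ] ℂ) u
        (posSemidef_vecMulVec_self_star (star U)).isHermitian
      simp only [ContinuousLinearMap.coe_coe] at e
      rw [← form_star_eq_sum] at e
      simp only [star_star] at e
      rw [e]
      have htrU : (vecMulVec (star U) U).trace = ((∑ x, ‖U x‖ ^ 2 : ℝ) : ℂ) := by
        simp [trace, vecMulVec_apply, Complex.conj_mul']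
      rw [htrU, ← Complex.ofReal_mul, ← Complex.ofReal_sub, Complex.zero_le_real]
      have hsum : ∀ x, ‖U x‖ ^ 2 ≤ ∑ x, ‖U x‖ ^ 2 := fun x =>
        Finset.single_le_sum (f := fun x => ‖U x‖ ^ 2) (fun _ _ => sq_nonneg _) (Finset.mem_univ x)
      set N := ∑ x, ‖U x‖ ^ 2 with hN
      have hN0 : 0 ≤ N := Finset.sum_nonneg fun _ _ => sq_nonneg _
      set c := Real.sqrt N with hc
      have hcc : c * c = N := Real.mul_self_sqrt hN0
      rcases hN0.eq_or_lt with h0 | hpos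
      · have : U = 0 := by
          funext x
          have := hsum x
          rw [← h0] at this
          simpa using le_antisymm this (sq_nonneg _)
        simp [this, ← h0]
      -- Rescaling by the Euclidean norm c puts the vector in S; the strict bound there gives u * N
      -- < Re g.
      · have hcpos : 0 < c := Real.sqrt_pos.2 hpos
        have hV : ((c⁻¹ : ℝ) : ℂ) • star U ∈ S := by
          refine ⟨?_, (schmidtRank_smul_le _ _).trans hU'⟩
          rw [mem_closedBall_zero_iff, norm_smul, Complex.norm_real, Real.norm_of_nonneg
            (inv_nonneg.2 hcpos.le), inv_mul_le_iff₀ hcpos, mul_one,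
            pi_norm_le_iff_of_nonneg hcpos.le]
          intro x
          rw [Pi.star_apply, norm_star]
          exact Real.le_sqrt_of_sq_le (hsum x)
        have := hgS _ hV
        have e2 : F (((c⁻¹ : ℝ) : ℂ) • star U) = ((N⁻¹ : ℝ) : ℂ) • vecMulVec (star U) U := by
          simp only [F, star_smul, star_star, smul_vecMulVec, vecMulVec_smul, smul_smul, ← hcc]
          simp
        rw [e2, map_smul, smul_eq_mul, Complex.re_ofReal_mul, lt_inv_mul_iff₀ hpos] at this
        linarith

/-- The cone of matrices with a Schmidt decomposition of length `k` is dual to the cone of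
`k`-block positive matrices. -/
theorem hasSchmidtDecomposition_of_forall_isBlockPositive {n m k : ℕ}
    {ρ : Matrix (Fin n × Fin m) (Fin n × Fin m) ℂ} (hρ : ρ.PosSemidef)
    (h : ∀ M, IsBlockPositive k M → 0 ≤ ∑ x, ∑ y, M x y * ρ x y) :
    HasSchmidtDecomposition k ρ := by
  by_cases h0 : ρ.trace = 0
  · rw [hρ.trace_eq_zero_iff] at h0
    exact ⟨0, fun l => l.elim0, fun l => l.elim0, by simp [h0]⟩
  · obtain ⟨t, ht, htr⟩ : ∃ t : ℝ, 0 ≤ t ∧ ρ.trace = t :=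
      ⟨ρ.trace.re, (Complex.nonneg_iff.1 hρ.trace_nonneg).1,
        (Complex.eq_re_of_ofReal_le hρ.trace_nonneg)⟩
    have ht0 : (t : ℂ) ≠ 0 := htr ▸ h0
    have hpos : (0 : ℂ) ≤ (t : ℂ)⁻¹ := inv_nonneg.2 (Complex.zero_le_real.2 ht)
    have := hasSchmidtDecomposition_of_trace_eq_one (k := k) (hρ.smul hpos).isHermitian
      (by rw [trace_smul, htr, smul_eq_mul, inv_mul_cancel₀ ht0]) fun M hM => by
        have := mul_nonneg hpos (h M hM)
        simpa [Finset.mul_sum, mul_left_comm] using this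
    simpa [smul_smul, ht0] using this.smul ht

/-! ### Functionals, density matrices and k-separability. -/

theorem functional_eq_sum {n m : ℕ} (f : Matrix (Fin n) (Fin n) (Mat m) →ₗ[ℂ] ℂ)
    (a : Matrix (Fin n) (Fin n) (Mat m)) :
    f a = ∑ x, ∑ y, comp (Fin n) (Fin n) (Fin m) (Fin m) ℂ a x y * densityMatrix f x y := by
  have ha : a = ∑ i, ∑ j, ∑ g, ∑ h,
      a i j g h • single i j (single g h (1 : ℂ)) := by
    conv_lhs => rw [matrix_eq_sum_single a]
    refine Finset.sum_congr rfl fun i _ => Finset.sum_congr rfl fun j _ => ?_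
    conv_lhs => rw [matrix_eq_sum_single (a i j)]
    ext i' j' g' h'
    simp only [Matrix.sum_apply, Matrix.smul_apply, single_apply]
    split_ifs with hij <;> simp [Matrix.sum_apply, single_apply]
  conv_lhs => rw [ha]
  simp only [map_sum, map_smul, smul_eq_mul, Fintype.sum_prod_type, comp_apply, densityMatrix,
    of_apply]
  exact Finset.sum_congr rfl fun _ _ => Finset.sum_comm

theorem functional_one {n m : ℕ} (f : Matrix (Fin n) (Fin n) (Mat m) →ₗ[ℂ] ℂ) :
    f 1 = (densityMatrix f).trace := by
  rw [functional_eq_sum, comp_one]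
  simp [one_apply, trace]

theorem densityMatrix_smul {n m : ℕ} (c : ℂ) (f : Matrix (Fin n) (Fin n) (Mat m) →ₗ[ℂ] ℂ) :
    densityMatrix (c • f) = c • densityMatrix f := rfl

theorem eq_zero_of_densityMatrix_eq_zero {n m : ℕ}
    {f : Matrix (Fin n) (Fin n) (Mat m) →ₗ[ℂ] ℂ} (h : densityMatrix f = 0) : f = 0 := by
  ext1 a
  simp [functional_eq_sum f a, h]

theorem IsPositiveFunctional.posSemidef_densityMatrix {n m : ℕ}
    {f : Matrix (Fin n) (Fin n) (Mat m) →ₗ[ℂ] ℂ} (hf : IsPositiveFunctional f) :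
    (densityMatrix f).PosSemidef := by
  refine posSemidef_of_forall_nonneg fun v => ?_
  have := hf ((comp (Fin n) (Fin n) (Fin m) (Fin m) ℂ).symm (vecMulVec (star v) v))
    (by simpa [natCones] using posSemidef_vecMulVec_star_self v)
  rw [functional_eq_sum, Equiv.apply_symm_apply] at this
  rw [dotProduct_mulVec_eq_sum]
  simpa [vecMulVec_apply, mul_right_comm] using this

theorem IsPositiveFunctional.eq_zero {n m : ℕ}
    {f : Matrix (Fin n) (Fin n) (Mat m) →ₗ[ℂ] ℂ} (hf : IsPositiveFunctional f) (h1 : f 1 = 0) :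
    f = 0 := by
  rw [functional_one, hf.posSemidef_densityMatrix.trace_eq_zero_iff] at h1
  exact eq_zero_of_densityMatrix_eq_zero h1

theorem one_mem_natCones (n m : ℕ) : (1 : Matrix (Fin n) (Fin n) (Mat m)) ∈ natCones m n := by
  simpa [natCones, comp_one] using PosSemidef.one

theorem natCones_subset_ominCones {k p n : ℕ} {a : Matrix (Fin n) (Fin n) (Mat p)}
    (ha : a ∈ natCones p n) : a ∈ ominCones k (natCones p) 1 n :=
  IsBlockPositive.mem_ominCones fun U _ => PosSemidef.dotProduct_mulVec_nonneg ha U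

theorem IsPositiveFunctional.one_eq_ofReal {n m : ℕ}
    {f : Matrix (Fin n) (Fin n) (Mat m) →ₗ[ℂ] ℂ} (hf : IsPositiveFunctional f) :
    ∃ t : ℝ, 0 ≤ t ∧ f 1 = t := by
  have := hf 1 (one_mem_natCones n m)
  exact ⟨(f 1).re, (Complex.nonneg_iff.1 this).1, Complex.eq_re_of_ofReal_le this⟩

/-- Schmidt decompositions survive nonnegative scaling, so normalization plays no role. -/
theorem isKSeparable_iff {n m k : ℕ} {f : Matrix (Fin n) (Fin n) (Mat m) →ₗ[ℂ] ℂ}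
    (hf : IsPositiveFunctional f) :
    IsKSeparable k f ↔ HasSchmidtDecomposition k (densityMatrix f) := by
  obtain ⟨t, ht, htf⟩ := hf.one_eq_ofReal
  by_cases h0 : f 1 = 0
  · have hf0 := hf.eq_zero h0
    refine ⟨fun _ => ⟨0, fun l => l.elim0, fun l => l.elim0, ?_⟩,
      fun _ => ⟨hf, fun h => absurd hf0 h⟩⟩
    simp only [hf0, Finset.univ_eq_empty, Finset.sum_empty]
    rfl
  have ht0 : (t : ℂ) ≠ 0 := htf ▸ h0
  have hfne : f ≠ 0 := fun h => h0 (by simp [h])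
  have hpos : IsPositiveFunctional ((f 1)⁻¹ • f) := fun a ha =>
    mul_nonneg (inv_nonneg.2 (hf 1 (one_mem_natCones n m))) (hf a ha)
  constructor
  · rintro ⟨-, h⟩
    obtain ⟨-, hk⟩ := h hfne
    have := (Nat.sInf_mem (s := {r | HasSchmidtDecomposition r (densityMatrix ((f 1)⁻¹ • f))})
      (exists_hasSchmidtDecomposition_of_posSemidef hpos.posSemidef_densityMatrix)).mono hk
    rw [densityMatrix_smul, htf] at this
    simpa [smul_smul, ht0] using this.smul ht
  · refine fun h => ⟨hf, fun _ => ⟨⟨hpos, by simp [h0]⟩, Nat.sInf_le ?_⟩⟩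
    have := h.smul (inv_nonneg.2 ht)
    rwa [Complex.ofReal_inv, ← htf] at this

/-! ### Vector states and the two implications. -/

/-- The vector functional `a ↦ w* a w` on `M_n(M_m)`. -/
noncomputable def vectorFunctional {n m : ℕ} (w : Fin n × Fin m → ℂ) :
    Matrix (Fin n) (Fin n) (Mat m) →ₗ[ℂ] ℂ where
  toFun a := star w ⬝ᵥ (comp (Fin n) (Fin n) (Fin m) (Fin m) ℂ a *ᵥ w)
  map_add' a b := by
    rw [← dotProduct_add, ← add_mulVec]; rfl
  map_smul' c a := by
    rw [RingHom.id_apply, ← dotProduct_smul, ← smul_mulVec]; rfl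

theorem vectorFunctional_apply {n m : ℕ} (w : Fin n × Fin m → ℂ)
    (a : Matrix (Fin n) (Fin n) (Mat m)) :
    vectorFunctional w a = star w ⬝ᵥ (comp (Fin n) (Fin n) (Fin m) (Fin m) ℂ a *ᵥ w) := rfl

theorem isState_vectorFunctional {n m : ℕ} {w : Fin n × Fin m → ℂ} (hw : w ≠ 0) :
    IsState ((star w ⬝ᵥ w)⁻¹ • vectorFunctional w) := by
  refine ⟨fun a ha => mul_nonneg (inv_nonneg.2 (dotProduct_star_self_nonneg w))
    (PosSemidef.dotProduct_mulVec_nonneg ha w), ?_⟩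
  rw [LinearMap.smul_apply, vectorFunctional_apply, comp_one, one_mulVec, smul_eq_mul,
    inv_mul_cancel₀]
  simpa using hw

theorem IsKPEB.isCompletelyPositive {k p m : ℕ} {φ : Mat p →ₗ[ℂ] Mat m} (h : IsKPEB k φ) :
    IsCompletelyPositive (ominCones k (natCones p) 1) (natCones m) φ := by
  intro n a ha
  refine posSemidef_of_forall_nonneg fun w => ?_
  rcases eq_or_ne w 0 with rfl | hw
  · simp
  -- Positivity of φ⁽ⁿ⁾(a) is tested on normalized vector states.
  have hs := h n _ (isState_vectorFunctional hw)
  have := (isBlockPositive_of_mem_ominCones ha).sum_mul_nonneg ((isKSeparable_iff hs.1).1 hs)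
  rw [← functional_eq_sum, LinearMap.comp_apply, LinearMap.smul_apply, vectorFunctional_apply,
    smul_eq_mul] at this
  have hne : star w ⬝ᵥ w ≠ 0 := by simpa using hw
  have := mul_nonneg (dotProduct_star_self_nonneg w) this
  rwa [mul_inv_cancel_left₀ hne] at this

theorem isKPEB_of_isCompletelyPositive {k p m : ℕ} {φ : Mat p →ₗ[ℂ] Mat m}
    (h : IsCompletelyPositive (ominCones k (natCones p) 1) (natCones m) φ) : IsKPEB k φ := by
  intro n s hs
  have hf : IsPositiveFunctional (s ∘ₗ amp n φ) := fun a ha =>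
    hs.1 _ (h n a (natCones_subset_ominCones ha))
  refine (isKSeparable_iff hf).2
    (hasSchmidtDecomposition_of_forall_isBlockPositive hf.posSemidef_densityMatrix fun M hM => ?_)
  have := hs.1 _ (h n ((comp (Fin n) (Fin n) (Fin p) (Fin p) ℂ).symm M)
    (IsBlockPositive.mem_ominCones (by rwa [Equiv.apply_symm_apply])))
  rwa [← LinearMap.comp_apply, functional_eq_sum, Equiv.apply_symm_apply] at this

end KPEB

theorem mainTheorem2 (k p m : ℕ) (hk : 1 ≤ k)
    (φ : KPEB.Mat p →ₗ[ℂ] KPEB.Mat m) :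
    KPEB.IsKPEB k φ ↔
      KPEB.IsCompletelyPositive (KPEB.ominCones k (KPEB.natCones p) 1) (KPEB.natCones m) φ := by
  exact ⟨KPEB.IsKPEB.isCompletelyPositive, KPEB.isKPEB_of_isCompletelyPositive⟩
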